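/- Let $P$ be any finite poset, say on the set $\{1,2,\ldots,n\}$, and let $e_1,\ldots,e_n$ be the standard basis of $\mathbb{R}^n$. Let $$K^{\mathrm{root}}_P=\mathbb{R}_+\{e_i-e_j : i<_P j\},\qquad K^{\mathrm{wt}}_P=\{x\in\mathbb{R}_+^n : x_i\ge x_j \text{ whenever } i<_P j\},$$ and let $L^{\mathrm{root}}$ be the lattice generated by all differences $e_i-e_j$ ($1\le i,j\le n$), and $L^{\mathrm{wt}}=\mathbb{Z}^n$. An extreme ray of a cone $K$ is a half-line $\mathbb{R}_+u$, $u\neq 0$, that is a face of $K$; the primitive vector of a lattice $L$ on such a ray is the nonzero vector of $L$ on the ray that is nearest to the origin. Then for $(K,L)=(K^{\mathrm{root}}_P,L^{\mathrm{root}})$ and for $(K,L)=(K^{\mathrm{wt}}_P,L^{\mathrm{wt}})$, the affine semigroup $K\cap L$ (with identity $0$) is generated by the primitive lattice vectors lying on the extreme rays of $K$: these vectors belong to $K\cap L$, and every element of $K\cap L$ is a finite (possibly empty) sum of them, with repetitions allowed. -/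

import Mathlib

namespace PosetCone

section General

variable {E : Type*} [NormedAddCommGroup E] [NormedSpace ℝ E]

/-- `R` is an extreme ray of the cone `K`: a half-line `ℝ₊ u` with `u ≠ 0` which is a face of `K`,
that is, a one-dimensional pointed face. -/
def IsExtremeRay (K R : PointedCone ℝ E) : Prop :=
  (∃ u : E, u ≠ 0 ∧ R = PointedCone.hull ℝ {u}) ∧ R.IsFaceOf K

/-- `u` is a primitive vector of the lattice `L` on the ray `R`: a nonzero point of `L` on `R`
nearest to the origin. -/
def IsPrimitiveOn (L : AddSubgroup E) (R : PointedCone ℝ E) (u : E) : Prop :=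
  u ∈ L ∧ u ∈ R ∧ u ≠ 0 ∧ ∀ w : E, w ∈ L → w ∈ R → w ≠ 0 → ‖u‖ ≤ ‖w‖

/-- The primitive lattice vectors lying on the extreme rays of `K`. -/
def primitiveRayVectors (K : PointedCone ℝ E) (L : AddSubgroup E) : Set E :=
  {u | ∃ R : PointedCone ℝ E, IsExtremeRay K R ∧ IsPrimitiveOn L R u}

/-- The affine semigroup `K ∩ L`, under addition of vectors. -/
def affineSemigroup (K : PointedCone ℝ E) (L : AddSubgroup E) : AddSubmonoid E :=
  K.toAddSubmonoid ⊓ L.toAddSubmonoid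

end General

section Poset

variable (P : Type*) [Fintype P]

/-- The cone `ℝ₊{e_i - e_j : i < j}`. -/
noncomputable def rootCone [DecidableEq P] [PartialOrder P] :
    PointedCone ℝ (EuclideanSpace ℝ P) :=
  PointedCone.hull ℝ {v | ∃ i j : P, i < j ∧
    v = EuclideanSpace.single i (1 : ℝ) - EuclideanSpace.single j (1 : ℝ)}

/-- The cone of nonnegative vectors `x` with `x_i ≥ x_j` whenever `i < j`. -/
def wtCone [PartialOrder P] : PointedCone ℝ (EuclideanSpace ℝ P) where
  carrier := {x | (∀ i, 0 ≤ x i) ∧ ∀ i j : P, i < j → x j ≤ x i}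
  zero_mem' := by simp
  add_mem' := by
    rintro x y ⟨hx, hx'⟩ ⟨hy, hy'⟩
    exact ⟨fun i => add_nonneg (hx i) (hy i),
      fun i j h => add_le_add (hx' i j h) (hy' i j h)⟩
  smul_mem' := by
    rintro ⟨c, hc⟩ x ⟨hx, hx'⟩
    exact ⟨fun i => mul_nonneg hc (hx i),
      fun i j h => mul_le_mul_of_nonneg_left (hx' i j h) hc⟩

/-- The lattice generated by all differences `e_i - e_j` (no order relation is involved). -/
noncomputable def rootLattice [DecidableEq P] : AddSubgroup (EuclideanSpace ℝ P) :=
  AddSubgroup.closure {v | ∃ i j : P,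
    v = EuclideanSpace.single i (1 : ℝ) - EuclideanSpace.single j (1 : ℝ)}

/-- The lattice of vectors with integer coordinates. -/
def wtLattice : AddSubgroup (EuclideanSpace ℝ P) where
  carrier := {x | ∀ i, ∃ m : ℤ, x i = m}
  zero_mem' := fun _ => ⟨0, by simp⟩
  add_mem' := by
    intro x y hx hy i
    obtain ⟨a, ha⟩ := hx i
    obtain ⟨b, hb⟩ := hy i
    exact ⟨a + b, by simp [ha, hb]⟩
  neg_mem' := by
    intro x hx i
    obtain ⟨a, ha⟩ := hx i
    exact ⟨-a, by simp [ha]⟩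

end Poset

end PosetCone

set_option linter.unusedSectionVars false

namespace PosetCone

/-! ### Rays and primitive vectors -/

section General

variable {E : Type*} [NormedAddCommGroup E] [NormedSpace ℝ E]

/-! Only generation needs work. In the weight cone, subtract from a nonzero lattice point the
indicator of a connected component of its support: this spans an extreme ray, the remainder stays in
the cone, and the coordinate sum drops. In the root cone, covers `i ⋖ j` give extreme rays `e_i -
e_j`. Sums over upper sets are nonpositive on the cone, which is exactly Hall's condition for
matching positive units of a lattice point to negative units above them (`exists_eq_sum_rootVec`).
Each matched pair then telescopes along a saturated chain of covers. -/

theorem mem_hull_singleton {u x : E} :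
    x ∈ PointedCone.hull ℝ {u} ↔ ∃ c : ℝ, 0 ≤ c ∧ x = c • u := by
  constructor
  · intro h
    obtain ⟨c, rfl⟩ := Submodule.mem_span_singleton.1 h
    exact ⟨c, c.2, rfl⟩
  · rintro ⟨c, hc, rfl⟩
    exact PointedCone.smul_mem _ hc (PointedCone.subset_hull rfl)

theorem closure_primitiveRayVectors_le (K : PointedCone ℝ E) (L : AddSubgroup E) :
    AddSubmonoid.closure (primitiveRayVectors K L) ≤ affineSemigroup K L := by
  rw [AddSubmonoid.closure_le]
  rintro u ⟨R, hR, hL, hu, -⟩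
  exact ⟨hR.2.le hu, hL⟩

end General

variable {P : Type*} [Fintype P]

/-- A lattice vector spanning a face is primitive as soon as the lattice is integral and one of
the coordinates of the vector equals `1`. -/
theorem mem_primitiveRayVectors {K : PointedCone ℝ (EuclideanSpace ℝ P)}
    {L : AddSubgroup (EuclideanSpace ℝ P)} (hL : L ≤ wtLattice P) {u : EuclideanSpace ℝ P}
    {k : P} (hk : u k = 1) (huL : u ∈ L) (huK : u ∈ K)
    (hface : ∀ x ∈ K, ∀ y ∈ K, ∀ a c : ℝ, 0 < a → a • x + y = c • u →
      ∃ t : ℝ, 0 ≤ t ∧ x = t • u) :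
    u ∈ primitiveRayVectors K L := by
  have hu : u ≠ 0 := by
    rintro rfl
    simp at hk
  refine ⟨PointedCone.hull ℝ {u}, ⟨⟨u, hu, rfl⟩, ?_, ?_⟩, huL, PointedCone.subset_hull rfl, hu, ?_⟩
  · intro x hx
    obtain ⟨c, hc, rfl⟩ := mem_hull_singleton.1 hx
    exact PointedCone.smul_mem _ hc huK
  · intro x y a hx hy ha h
    obtain ⟨c, -, h⟩ := mem_hull_singleton.1 h
    exact mem_hull_singleton.2 (hface x hx y hy a c ha h)
  · intro w hwL hw hw0
    obtain ⟨c, hc, rfl⟩ := mem_hull_singleton.1 hw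
    -- Coordinate `k` reads off the multiple `c`, so `c` is a positive integer.
    obtain ⟨m, hm⟩ := hL hwL k
    have hcm : c = m := by simpa [hk] using hm
    have hc0 : c ≠ 0 := by
      rintro rfl
      simp at hw0
    have hm1 : 1 ≤ m := by
      have : (0 : ℝ) < m := hcm ▸ lt_of_le_of_ne hc hc0.symm
      exact_mod_cast this
    have hc1 : (1 : ℝ) ≤ c := by
      rw [hcm]
      exact_mod_cast hm1
    rw [norm_smul, Real.norm_of_nonneg hc]
    exact le_mul_of_one_le_left (norm_nonneg u) hc1

/-! ### The weight cone: connected components of supports -/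

section Weight

variable [PartialOrder P]

/-- The connected component of `p` in the comparability graph of the support of `x`. -/
def supportComponent (x : EuclideanSpace ℝ P) (p : P) : Set P :=
  {j | Relation.ReflTransGen (fun a b => 0 < x b ∧ (a < b ∨ b < a)) p j}

theorem self_mem_supportComponent (x : EuclideanSpace ℝ P) (p : P) :
    p ∈ supportComponent x p := Relation.ReflTransGen.refl

theorem pos_of_mem_supportComponent {x : EuclideanSpace ℝ P} {p j : P} (hp : 0 < x p)
    (hj : j ∈ supportComponent x p) : 0 < x j := by
  rcases Relation.ReflTransGen.cases_tail hj with rfl | ⟨c, -, h⟩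
  exacts [hp, h.1]

open Classical in
/-- The `0`-`1` vector of a set. -/
noncomputable def indicatorVec (J : Set P) : EuclideanSpace ℝ P :=
  WithLp.toLp 2 (fun j => if j ∈ J then 1 else 0)

theorem indicatorVec_of_mem {J : Set P} {j : P} (h : j ∈ J) : indicatorVec J j = 1 := by
  simp [indicatorVec, h]

theorem indicatorVec_of_notMem {J : Set P} {j : P} (h : j ∉ J) : indicatorVec J j = 0 := by
  simp [indicatorVec, h]

theorem indicatorVec_nonneg (J : Set P) (j : P) : 0 ≤ indicatorVec J j := by
  by_cases h : j ∈ J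
  · simp [indicatorVec_of_mem h]
  · simp [indicatorVec_of_notMem h]

theorem indicatorVec_mem_wtLattice (J : Set P) : indicatorVec J ∈ wtLattice P := by
  intro j
  by_cases h : j ∈ J
  · exact ⟨1, by simp [indicatorVec_of_mem h]⟩
  · exact ⟨0, by simp [indicatorVec_of_notMem h]⟩

theorem isLowerSet_supportComponent {x : EuclideanSpace ℝ P} (hx : x ∈ wtCone P) {p : P}
    (hp : 0 < x p) : IsLowerSet (supportComponent x p) := by
  intro i j hji hi
  rcases hji.eq_or_lt with rfl | hlt
  · exact hi
  · exact Relation.ReflTransGen.tail hi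
      ⟨(pos_of_mem_supportComponent hp hi).trans_le (hx.2 j i hlt), Or.inr hlt⟩

theorem indicatorVec_mem_wtCone {J : Set P} (hJ : IsLowerSet J) : indicatorVec J ∈ wtCone P := by
  refine ⟨indicatorVec_nonneg J, fun i j hij => ?_⟩
  by_cases h : j ∈ J
  · rw [indicatorVec_of_mem h, indicatorVec_of_mem (hJ hij.le h)]
  · rw [indicatorVec_of_notMem h]
    exact indicatorVec_nonneg J i

/-- In a decomposition of a multiple of the indicator, both summands weakly decrease along the order
while their sum is constant on the component. So each is constant on comparable pairs, hence on the
connected component; outside it, nonnegativity forces zero. -/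
theorem indicatorVec_supportComponent_mem_primitiveRayVectors {x : EuclideanSpace ℝ P}
    (hx : x ∈ wtCone P) {p : P} (hp : 0 < x p) :
    indicatorVec (supportComponent x p) ∈ primitiveRayVectors (wtCone P) (wtLattice P) := by
  have hJ := isLowerSet_supportComponent hx hp
  refine mem_primitiveRayVectors le_rfl
    (indicatorVec_of_mem (self_mem_supportComponent x p)) (indicatorVec_mem_wtLattice _)
    (indicatorVec_mem_wtCone hJ) ?_
  intro v hv w hw a c ha h
  have hcoord : ∀ i, a * v i + w i = c * indicatorVec (supportComponent x p) i := fun i => by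
    simpa using congrArg (fun z : EuclideanSpace ℝ P => z i) h
  have hstep : ∀ i j, i < j → i ∈ supportComponent x p → j ∈ supportComponent x p →
      v i = v j := by
    intro i j hij hi hj
    have h1 := hcoord i
    have h2 := hcoord j
    rw [indicatorVec_of_mem hi] at h1
    rw [indicatorVec_of_mem hj] at h2
    have h3 := hw.2 i j hij
    refine le_antisymm ?_ (hv.2 i j hij)
    exact le_of_mul_le_mul_left (by linarith) ha
  have hconst : ∀ j ∈ supportComponent x p, v j = v p := by
    intro j hj
    induction hj with
    | refl => rfl
    | tail hb hbc ih =>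
      rcases hbc with ⟨hpos, hlt | hlt⟩
      · rw [← ih, hstep _ _ hlt hb (hb.tail ⟨hpos, Or.inl hlt⟩)]
      · rw [← ih, hstep _ _ hlt (hb.tail ⟨hpos, Or.inr hlt⟩) hb]
  refine ⟨v p, hv.1 p, ?_⟩
  ext i
  by_cases hi : i ∈ supportComponent x p
  · simp [indicatorVec_of_mem hi, hconst i hi]
  · have h1 := hcoord i
    rw [indicatorVec_of_notMem hi] at h1
    have h2 := hw.1 i
    have h3 : a * v i ≤ a * 0 := by linarith
    simp [indicatorVec_of_notMem hi, le_antisymm (le_of_mul_le_mul_left h3 ha) (hv.1 i)]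

theorem sub_indicatorVec_mem_wtCone {x : EuclideanSpace ℝ P} (hx : x ∈ wtCone P)
    (hxL : x ∈ wtLattice P) {p : P} (hp : 0 < x p) :
    x - indicatorVec (supportComponent x p) ∈ wtCone P := by
  have hone : ∀ j ∈ supportComponent x p, 1 ≤ x j := by
    intro j hj
    have h := pos_of_mem_supportComponent hp hj
    obtain ⟨m, hm⟩ := hxL j
    have hm' : x j = (m : ℝ) := hm
    have h1 : (0 : ℝ) < m := hm' ▸ h
    have h2 : 1 ≤ m := by exact_mod_cast h1
    have h3 : (1 : ℝ) ≤ m := by exact_mod_cast h2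
    exact h3.trans_eq hm'.symm
  have hJ := isLowerSet_supportComponent hx hp
  constructor
  · intro i
    by_cases hi : i ∈ supportComponent x p
    · simpa [indicatorVec_of_mem hi] using hone i hi
    · simpa [indicatorVec_of_notMem hi] using hx.1 i
  · intro i j hij
    have hle := hx.2 i j hij
    by_cases hj : j ∈ supportComponent x p
    · simpa [indicatorVec_of_mem hj, indicatorVec_of_mem (hJ hij.le hj)] using hle
    · by_cases hi : i ∈ supportComponent x p
      · have hj0 : x j ≤ 0 := by
          by_contra hpos
          exact hj (Relation.ReflTransGen.tail hi ⟨not_le.1 hpos, Or.inl hij⟩)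
        have := hone i hi
        simp only [PiLp.sub_apply, indicatorVec_of_mem hi, indicatorVec_of_notMem hj]
        linarith
      · simpa [indicatorVec_of_notMem hi, indicatorVec_of_notMem hj] using hle

theorem affineSemigroup_wtCone_le :
    affineSemigroup (wtCone P) (wtLattice P) ≤
      AddSubmonoid.closure (primitiveRayVectors (wtCone P) (wtLattice P)) := by
  -- Induct on a natural bound for the coordinate sum; each subtraction lowers the sum by at least
  -- one.
  suffices H : ∀ (n : ℕ) (x : EuclideanSpace ℝ P), x ∈ wtCone P → x ∈ wtLattice P →
      ∑ i, x i ≤ n → x ∈ AddSubmonoid.closure (primitiveRayVectors (wtCone P) (wtLattice P)) by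
    rintro x ⟨hx, hxL⟩
    obtain ⟨n, hn⟩ := exists_nat_ge (∑ i, x i)
    exact H n x hx hxL hn
  intro n
  induction n with
  | zero =>
    intro x hx _ hn
    have hsum : ∑ i, x i = 0 :=
      le_antisymm (by simpa using hn) (Finset.sum_nonneg fun i _ => hx.1 i)
    have h0 : x = 0 := by
      ext i
      exact (Finset.sum_eq_zero_iff_of_nonneg fun i _ => hx.1 i).1 hsum i (Finset.mem_univ i)
    rw [h0]
    exact zero_mem _
  | succ n ih =>
    intro x hx hxL hn
    by_cases h : ∃ p, 0 < x p
    · obtain ⟨p, hp⟩ := h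
      set u := indicatorVec (supportComponent x p) with hu
      have hsum : 1 ≤ ∑ i, u i := by
        rw [← indicatorVec_of_mem (self_mem_supportComponent x p)]
        exact Finset.single_le_sum (f := fun i => u i)
          (fun i _ => indicatorVec_nonneg _ i) (Finset.mem_univ p)
      have hrest := ih (x - u) (sub_indicatorVec_mem_wtCone hx hxL hp)
        (sub_mem hxL (indicatorVec_mem_wtLattice _)) (by
          simp only [PiLp.sub_apply, Finset.sum_sub_distrib]
          push_cast at hn
          linarith)
      rw [← sub_add_cancel x u]
      exact add_mem hrest (AddSubmonoid.subset_closure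
        (indicatorVec_supportComponent_mem_primitiveRayVectors hx hp))
    · push Not at h
      have h0 : x = 0 := by
        ext i
        exact le_antisymm (h i) (hx.1 i)
      rw [h0]
      exact zero_mem _

end Weight

/-! ### The root cone: upper-set inequalities and matching -/

section Root

variable [DecidableEq P]

/-- The vector `e_i - e_j`. -/
noncomputable def rootVec (i j : P) : EuclideanSpace ℝ P :=
  EuclideanSpace.single i (1 : ℝ) - EuclideanSpace.single j (1 : ℝ)

theorem rootVec_apply (i j k : P) :
    rootVec i j k = (if k = i then (1 : ℝ) else 0) - (if k = j then 1 else 0) := by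
  simp [rootVec]

theorem rootVec_self (i : P) : rootVec i i = 0 := sub_self _

theorem rootVec_add_rootVec (i j k : P) : rootVec i j + rootVec j k = rootVec i k :=
  sub_add_sub_cancel _ _ _

theorem sum_rootVec (U : Finset P) (i j : P) :
    ∑ k ∈ U, rootVec i j k = (if i ∈ U then (1 : ℝ) else 0) - (if j ∈ U then 1 else 0) := by
  simp [rootVec_apply, Finset.sum_sub_distrib]

theorem rootVec_mem_rootLattice (i j : P) : rootVec i j ∈ rootLattice P :=
  AddSubgroup.subset_closure ⟨i, j, rfl⟩

theorem rootLattice_le_wtLattice : rootLattice P ≤ wtLattice P := by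
  rw [rootLattice, AddSubgroup.closure_le]
  rintro v ⟨i, j, rfl⟩ k
  refine ⟨(if k = i then 1 else 0) - (if k = j then 1 else 0), ?_⟩
  push_cast
  exact rootVec_apply i j k

variable [PartialOrder P]

theorem rootVec_mem_rootCone {i j : P} (h : i < j) : rootVec i j ∈ rootCone P :=
  PointedCone.subset_hull ⟨i, j, h, rfl⟩

theorem sum_nonpos_and_sum_eq_zero {x : EuclideanSpace ℝ P} (hx : x ∈ rootCone P) :
    (∀ U : Finset P, IsUpperSet (U : Set P) → ∑ k ∈ U, x k ≤ 0) ∧ ∑ k, x k = 0 := by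
  induction hx using Submodule.span_induction with
  | mem v hv =>
    obtain ⟨i, j, hij, rfl⟩ := hv
    constructor
    · intro U hU
      refine (sum_rootVec U i j).trans_le ?_
      by_cases hi : i ∈ U
      · have hj : j ∈ U := hU hij.le hi
        simp [hi, hj]
      · by_cases hj : j ∈ U <;> simp [hi, hj]
    · exact (sum_rootVec Finset.univ i j).trans (by simp)
  | zero => simp
  | add v w _ _ hv hw =>
    constructor
    · intro U hU
      simpa [Finset.sum_add_distrib] using add_nonpos (hv.1 U hU) (hw.1 U hU)
    · simp [Finset.sum_add_distrib, hv.2, hw.2]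
  | smul c v _ hv =>
    have happ : ∀ k, (c • v) k = (c : ℝ) * v k := fun k => rfl
    constructor
    · intro U hU
      simp only [happ, ← Finset.mul_sum]
      exact mul_nonpos_of_nonneg_of_nonpos c.2 (hv.1 U hU)
    · simp only [happ, ← Finset.mul_sum, hv.2, mul_zero]

/-- An upper set containing both or neither of `i`, `j` gives a functional that vanishes on `e_i -
e_j` and is nonpositive on both summands, so it vanishes on each. -/
theorem sum_eq_zero_of_smul_add_eq {x y : EuclideanSpace ℝ P} (hx : x ∈ rootCone P)
    (hy : y ∈ rootCone P) {a c : ℝ} (ha : 0 < a) {i j : P} (hij : i < j)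
    (h : a • x + y = c • rootVec i j) (U : Finset P) (hU : IsUpperSet (U : Set P))
    (hsep : j ∈ U → i ∈ U) : ∑ k ∈ U, x k = 0 := by
  have h1 : a * ∑ k ∈ U, x k + ∑ k ∈ U, y k = 0 := by
    have h2 : ∑ k ∈ U, (a • x + y) k = ∑ k ∈ U, (c • rootVec i j) k := by rw [h]
    simp only [PiLp.add_apply, PiLp.smul_apply, smul_eq_mul, Finset.sum_add_distrib,
      ← Finset.mul_sum, sum_rootVec] at h2
    rw [h2]
    by_cases hj : j ∈ U
    · simp [hj, hsep hj]
    · have hi : i ∉ U := fun hi => hj (hU hij.le hi)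
      simp [hi, hj]
  have h3 := (sum_nonpos_and_sum_eq_zero hx).1 U hU
  have h4 := (sum_nonpos_and_sum_eq_zero hy).1 U hU
  refine le_antisymm h3 ?_
  exact le_of_mul_le_mul_left (by linarith : a * 0 ≤ a * ∑ k ∈ U, x k) ha

theorem rootVec_mem_primitiveRayVectors {i j : P} (hij : i ⋖ j) :
    rootVec i j ∈ primitiveRayVectors (rootCone P) (rootLattice P) := by
  classical
  have hne : i ≠ j := hij.lt.ne
  refine mem_primitiveRayVectors (k := i) rootLattice_le_wtLattice (by simp [rootVec_apply, hne])
    (rootVec_mem_rootLattice i j) (rootVec_mem_rootCone hij.lt) ?_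
  intro x hx y hy a c ha h
  have hzero : ∀ k, k ≠ i → k ≠ j → x k = 0 := by
    intro k hki hkj
    -- `x k` is the difference of the sums over two upper sets, neither separating `i` from `j`.
    suffices H : ∃ V : Finset P, k ∉ V ∧ IsUpperSet (V : Set P) ∧
        IsUpperSet ((insert k V : Finset P) : Set P) ∧ (j ∈ V → i ∈ V) by
      obtain ⟨V, hkV, hV, hkV', hsep⟩ := H
      have h1 := sum_eq_zero_of_smul_add_eq hx hy ha hij.lt h V hV hsep
      have h2 := sum_eq_zero_of_smul_add_eq hx hy ha hij.lt h (insert k V) hkV'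
        (fun hj => Finset.mem_insert_of_mem
          (hsep ((Finset.mem_insert.1 hj).resolve_left hkj.symm)))
      rw [Finset.sum_insert hkV, h1, add_zero] at h2
      exact h2
    -- If `i < k`, the cover relation keeps `j` out of the elements above `k`. Otherwise adjoining
    -- all elements above `i` puts `i` in the set without capturing `k`.
    by_cases hik : i < k
    · refine ⟨Finset.univ.filter (fun l => k < l), by simp, ?_, ?_, ?_⟩
      · intro l m hlm hl
        simp only [Finset.coe_filter, Finset.mem_univ, true_and, Set.mem_ofPred_eq] at hl ⊢
        exact hl.trans_le hlm
      · intro l m hlm hl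
        simp only [Finset.coe_insert, Finset.coe_filter, Finset.mem_univ, true_and,
          Set.mem_insert_iff, Set.mem_ofPred_eq] at hl ⊢
        have hkl : k ≤ l := hl.elim (fun e => e.ge) le_of_lt
        exact (hkl.trans hlm).eq_or_lt.imp Eq.symm id
      · intro hj
        exact absurd (Finset.mem_filter.1 hj).2 (hij.2 hik)
    · have hik' : ¬ i ≤ k := fun hle => hik (lt_of_le_of_ne hle hki.symm)
      refine ⟨Finset.univ.filter (fun l => k < l ∨ i ≤ l), by simp [hik'], ?_, ?_, ?_⟩
      · intro l m hlm hl
        simp only [Finset.coe_filter, Finset.mem_univ, true_and, Set.mem_ofPred_eq] at hl ⊢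
        exact hl.imp (fun h => h.trans_le hlm) (fun h => h.trans hlm)
      · intro l m hlm hl
        simp only [Finset.coe_insert, Finset.coe_filter, Finset.mem_univ, true_and,
          Set.mem_insert_iff, Set.mem_ofPred_eq] at hl ⊢
        have hl' : k ≤ l ∨ i ≤ l := by
          rcases hl with e | h | h
          exacts [Or.inl e.ge, Or.inl h.le, Or.inr h]
        rcases hl' with hkl | hil
        · rcases (hkl.trans hlm).eq_or_lt with e | hlt
          exacts [Or.inl e.symm, Or.inr (Or.inl hlt)]
        · exact Or.inr (Or.inr (hil.trans hlm))
      · intro _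
        simp
  have hsum : x i + x j = 0 := by
    rw [← (sum_nonpos_and_sum_eq_zero hx).2]
    exact (Finset.sum_eq_add i j hne (fun k _ hk => hzero k hk.1 hk.2) (by simp) (by simp)).symm
  have hxj : x j ≤ 0 := by
    have h1 := (sum_nonpos_and_sum_eq_zero hx).1 (Finset.univ.filter (fun l => j ≤ l)) (by
      intro l m hlm hl
      simp only [Finset.coe_filter, Finset.mem_univ, true_and, Set.mem_ofPred_eq] at hl ⊢
      exact hl.trans hlm)
    rwa [Finset.sum_eq_single j] at h1
    · intro k hk hkj
      refine hzero k ?_ hkj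
      rintro rfl
      exact hij.lt.not_ge (Finset.mem_filter.1 hk).2
    · simp
  refine ⟨x i, by linarith, ?_⟩
  ext k
  by_cases hki : k = i
  · subst hki
    simp [rootVec_apply, hne]
  · by_cases hkj : k = j
    · subst hkj
      simp only [PiLp.smul_apply, rootVec_apply, if_neg hki, smul_eq_mul, if_true]
      linarith
    · simp [rootVec_apply, hki, hkj, hzero k hki hkj]

theorem rootVec_mem_closure {i j : P} (hij : i ≤ j) :
    rootVec i j ∈ AddSubmonoid.closure (primitiveRayVectors (rootCone P) (rootLattice P)) := by
  -- Climb from `i` towards `j`, one cover at a time.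
  induction i using (Finite.wellFounded_of_trans_of_irrefl (α := P) (· > ·)).induction with
  | _ i ih =>
    rcases hij.eq_or_lt with rfl | hlt
    · rw [rootVec_self]
      exact zero_mem _
    · have : IsStronglyAtomic P := inferInstance
      obtain ⟨k, hik, hkj⟩ := exists_covBy_le_of_lt hlt
      rw [← rootVec_add_rootVec i k j]
      exact add_mem (AddSubmonoid.subset_closure (rootVec_mem_primitiveRayVectors hik))
        (ih k hik.lt hkj)

/-- An integral vector whose sums over upper sets are nonpositive and whose total is zero is
a sum of vectors `e_i - e_j` with `i ≤ j`, by Hall's marriage theorem. -/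
theorem exists_eq_sum_rootVec (z : P → ℤ)
    (hU : ∀ U : Finset P, IsUpperSet (U : Set P) → ∑ k ∈ U, z k ≤ 0) (hz : ∑ k, z k = 0) :
    ∃ f : (Σ i, Fin (z i).toNat) → (Σ j, Fin (-z j).toNat), (∀ s, s.1 ≤ (f s).1) ∧
      WithLp.toLp 2 (fun k => (z k : ℝ)) = ∑ s, rootVec s.1 (f s).1 := by
  classical
  have hsplit : ∀ U : Finset P,
      ((∑ k ∈ U, (z k).toNat : ℕ) : ℤ) - ((∑ k ∈ U, (-z k).toNat : ℕ) : ℤ) = ∑ k ∈ U, z k := by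
    intro U
    push_cast
    rw [← Finset.sum_sub_distrib]
    exact Finset.sum_congr rfl fun k _ => by omega
  obtain ⟨f, hinj, hf⟩ := (Finset.all_card_le_biUnion_card_iff_exists_injective
    (fun s : Σ i, Fin (z i).toNat =>
      Finset.univ.filter (fun τ : Σ j, Fin (-z j).toNat => s.1 ≤ τ.1))).1 (by
    intro A
    -- Over the upper set generated by `A`, the positive units include `A` and the negative units
    -- are all neighbours of `A`; the sign of the sum over `U` compares their numbers.
    set U : Finset P := Finset.univ.filter (fun l => ∃ s ∈ A, s.1 ≤ l) with hUdef
    have hUup : IsUpperSet (U : Set P) := by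
      intro l m hlm hl
      simp only [hUdef, Finset.coe_filter, Finset.mem_univ, true_and, Set.mem_ofPred_eq] at hl ⊢
      obtain ⟨s, hs, hsl⟩ := hl
      exact ⟨s, hs, hsl.trans hlm⟩
    have hA : A ⊆ U.sigma (fun _ => Finset.univ) := by
      intro s hs
      simp only [hUdef, Finset.mem_sigma, Finset.mem_filter, Finset.mem_univ, true_and, and_true]
      exact ⟨s, hs, le_rfl⟩
    have hN : U.sigma (fun j => (Finset.univ : Finset (Fin (-z j).toNat))) ⊆ A.biUnion
        (fun s => Finset.univ.filter (fun τ : Σ j, Fin (-z j).toNat => s.1 ≤ τ.1)) := by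
      intro τ hτ
      simpa [hUdef] using hτ
    refine (Finset.card_le_card hA).trans (le_trans ?_ (Finset.card_le_card hN))
    simp only [Finset.card_sigma, Finset.card_univ, Fintype.card_fin]
    have h1 := hsplit U
    have h2 := hU U hUup
    omega)
  -- Total zero equalizes the two counts, so every negative unit is used exactly once.
  have hbij : Function.Bijective f := by
    rw [Fintype.bijective_iff_injective_and_card]
    refine ⟨hinj, ?_⟩
    simp only [Fintype.card_sigma, Fintype.card_fin]
    have h1 := hsplit Finset.univ
    omega
  refine ⟨f, fun s => by simpa using hf s, ?_⟩
  have h1 : ∑ s, EuclideanSpace.single (f s).1 (1 : ℝ) =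
      ∑ τ : Σ j, Fin (-z j).toNat, EuclideanSpace.single τ.1 (1 : ℝ) :=
    hbij.sum_comp (fun τ : Σ j, Fin (-z j).toNat => EuclideanSpace.single τ.1 (1 : ℝ))
  simp only [rootVec, Finset.sum_sub_distrib, h1]
  rw [Fintype.sum_sigma, Fintype.sum_sigma]
  ext k
  have h2 : (z k : ℝ) = ((z k).toNat : ℝ) - ((-z k).toNat : ℝ) := by
    have : z k = ((z k).toNat : ℤ) - ((-z k).toNat : ℤ) := by omega
    exact_mod_cast congrArg (Int.cast : ℤ → ℝ) this
  simp [h2, Pi.single_apply]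

theorem affineSemigroup_rootCone_le :
    affineSemigroup (rootCone P) (rootLattice P) ≤
      AddSubmonoid.closure (primitiveRayVectors (rootCone P) (rootLattice P)) := by
  rintro x ⟨hx, hxL⟩
  choose z hz using rootLattice_le_wtLattice hxL
  have hsum := sum_nonpos_and_sum_eq_zero hx
  simp only [hz] at hsum
  obtain ⟨f, hf, hxf⟩ := exists_eq_sum_rootVec z (fun U hU => by exact_mod_cast hsum.1 U hU)
    (by exact_mod_cast hsum.2)
  have hxz : x = WithLp.toLp 2 (fun k => (z k : ℝ)) := by
    ext k
    exact hz k
  rw [hxz, hxf]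
  exact sum_mem fun s _ => rootVec_mem_closure (hf s)

end Root

end PosetCone

theorem mainTheorem10 (P : Type*) [Fintype P] [DecidableEq P] [PartialOrder P] :
    AddSubmonoid.closure
        (PosetCone.primitiveRayVectors (PosetCone.rootCone P) (PosetCone.rootLattice P)) =
      PosetCone.affineSemigroup (PosetCone.rootCone P) (PosetCone.rootLattice P) ∧
    AddSubmonoid.closure
        (PosetCone.primitiveRayVectors (PosetCone.wtCone P) (PosetCone.wtLattice P)) =
      PosetCone.affineSemigroup (PosetCone.wtCone P) (PosetCone.wtLattice P) :=
  ⟨le_antisymm (PosetCone.closure_primitiveRayVectors_le _ _)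
    PosetCone.affineSemigroup_rootCone_le,
   le_antisymm (PosetCone.closure_primitiveRayVectors_le _ _)
    PosetCone.affineSemigroup_wtCone_le⟩
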